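/- Let $\mathcal X$ be a set containing a symbol $0$, let $\mathcal Y$ be a finite or countably infinite set, let $W(\cdot|x)$, $x\in\mathcal X$, be probability distributions on $\mathcal Y$, and let $c:\mathcal X\to[0,\infty)$ be a cost function with $c(0)=0$. Let $S$ be a probability distribution on $\{0,1,2,\dots\}$ with finite mean $\mu$ and finite variance $\sigma^2$. The insertion/deletion/substitution channel formed by the insertion/deletion channel $\mathrm{IDC}(\mu,\sigma^2)$ followed by the discrete memoryless channel $\mathrm{DMC}(W)$ acts on an input $(x[1],\dots,x[T])\in\mathcal X^T$ as follows. Let $\mathsf s[1],\dots,\mathsf s[T]$ be i.i.d. with law $S$, put $\mathsf L=\sum_{t=1}^T\mathsf s[t]$, and for $1\le\ell\le\mathsf L$ let $\mathsf t[\ell]=\min\{t:\sum_{j=1}^t\mathsf s[j]\ge\ell\}$ and $\tilde{\mathsf x}[\ell]=x[\mathsf t[\ell]]$ (so each $x[t]$ is repeated $\mathsf s[t]$ times). The output is $(\mathsf y[1],\dots,\mathsf y[\mathsf L])$ where, given the states, the $\mathsf y[\ell]$ are independent with laws $W(\cdot|\tilde{\mathsf x}[\ell])$. A $(T,M,P,\varepsilon)$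 code consists of $M$ codewords in $\mathcal X^T$, each of cost $\sum_{t=1}^T c(x[t])\le P$, and a decoder that observes the output sequence (including its length $\mathsf L$), such that the probability of decoding error, averaged over $M$ equiprobable messages, is at most $\varepsilon$. A rate $\hat R\ge0$ per unit cost is achievable if for every $\varepsilon>0$ and every large enough $M$ there is a $(T,M,P,\varepsilon)$ code, for some $T$ and some $P>0$, with $\log_2(M)/P\ge\hat R$. The capacity per unit cost $\hat C(\mu,\sigma^2,W)\in[0,\infty]$ is the supremum of the achievable rates per unit cost ($0$ if there are none). Then $$\frac{\mu}{2}\,\sup_{x\in\mathcal X\setminus\{0\}}\frac{D(W(\cdot|x)\Vert W(\cdot|0))}{c(x)}\;\le\;\hat C(\mu,\sigma^2,W)\;\le\;\mu\,\sup_{x\in\mathcal X\setminus\{0\}}\frac{D(W(\cdot|x)\Vert W(\cdot|0))}{c(x)},$$ where $D(P\Vert Q)\in[0,\infty]$ is the Kullback–Leibler divergence in bits (logarithm to base $2$), with the conventions $a/0=\infty$ for $a>0$, $0/0=0$, $0\cdot\infty=0$, and the supremum over the empty set is $0$. -/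

import Mathlib

open MeasureTheory ProbabilityTheory
open scoped NNReal ENNReal

namespace IndelChannel

/-- The number of repetitions of an input symbol has law `S`, mean `μ` and (finite) variance `σ2`. -/
structure HasMeanVar (S : PMF ℕ) (μ σ2 : ℝ) : Prop where
  memLp : MemLp (fun k : ℕ => (k : ℝ)) 2 S.toMeasure
  mean : ∫ k : ℕ, (k : ℝ) ∂S.toMeasure = μ
  var : variance (fun k : ℕ => (k : ℝ)) S.toMeasure = σ2

theorem exists_samplingTime {T : ℕ} (s : Fin T → ℕ) (l : Fin (∑ t, s t)) :
    (Finset.univ.filter fun t : Fin T => (l : ℕ) < ∑ j ∈ Finset.Iic t, s j).Nonempty := by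
  obtain _ | n := T
  · exact absurd l.2 (by simp)
  · refine ⟨Fin.last n, ?_⟩
    have h : Finset.Iic (Fin.last n) = Finset.univ := by
      ext t
      simp [Fin.le_last]
    simp [h]

/-- The least `t` with `s 0 + ⋯ + s t ≥ l + 1`: the time of the input symbol that appears as the
output symbol number `l` of the insertion/deletion channel (positions are counted from `0`). -/
noncomputable def samplingTime {T : ℕ} (s : Fin T → ℕ) (l : Fin (∑ t, s t)) : Fin T :=
  (Finset.univ.filter fun t : Fin T => (l : ℕ) < ∑ j ∈ Finset.Iic t, s j).min'
    (exists_samplingTime s l)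

/-- Output of the insertion/deletion channel for the input `x` and the states `s`. -/
noncomputable def idcOutput {X : Type*} {T : ℕ} (x : Fin T → X) (s : Fin T → ℕ) :
    Fin (∑ t, s t) → X :=
  fun l => x (samplingTime s l)

/-- Law of the i.i.d. states of the insertion/deletion channel. -/
noncomputable def stateLaw (S : PMF ℕ) (T : ℕ) : Measure (Fin T → ℕ) :=
  Measure.pi fun _ => S.toMeasure

/-- Law of the output of the memoryless channel `W` for the input `x`. -/
noncomputable def dmcLaw {X Y : Type*} [MeasurableSpace Y] (W : X → PMF Y) {n : ℕ}
    (x : Fin n → X) : Measure (Fin n → Y) :=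
  Measure.pi fun i => (W (x i)).toMeasure

/-- A block code with `M` codewords of length `T`. The decoder sees the output sequence together
with its (random) length; the value `none` means that it declares an error. -/
structure Code (X Y : Type*) (T M : ℕ) where
  codeword : Fin M → Fin T → X
  decode : (n : ℕ) → (Fin n → Y) → Option (Fin M)

namespace Code

variable {X Y : Type*} [MeasurableSpace Y] {T M : ℕ}

/-- Probability of a decoding error when the message `m` is sent through the insertion/deletion
channel with state law `S` followed by the memoryless channel `W`. -/
noncomputable def errorProb (C : Code X Y T M) (S : PMF ℕ) (W : X → PMF Y) (m : Fin M) : ℝ≥0∞ :=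
  ∫⁻ s, dmcLaw W (idcOutput (C.codeword m) s) {y | C.decode (∑ t, s t) y ≠ some m}
    ∂(stateLaw S T)

/-- Average probability of error over equiprobable messages. -/
noncomputable def avgErrorProb (C : Code X Y T M) (S : PMF ℕ) (W : X → PMF Y) : ℝ≥0∞ :=
  (∑ m, C.errorProb S W m) / M

end Code

/-- There is a code with `M` codewords of length `T`, each of cost at most `P`, and average
probability of error at most `ε`. -/
def ExistsCode {X Y : Type*} [MeasurableSpace Y] (S : PMF ℕ) (W : X → PMF Y) (c : X → ℝ≥0)
    (T M : ℕ) (P : ℝ≥0) (ε : ℝ) : Prop :=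
  ∃ C : Code X Y T M, (∀ m, ∑ t, c (C.codeword m t) ≤ P) ∧ C.avgErrorProb S W ≤ ENNReal.ofReal ε

/-- The rate `R` (in bits) per unit cost is achievable. The cost bound `P` is only an upper bound
on the cost of the codewords; taking it positive keeps the quotient meaningful. -/
def Achievable {X Y : Type*} [MeasurableSpace Y] (S : PMF ℕ) (W : X → PMF Y) (c : X → ℝ≥0)
    (R : ℝ≥0) : Prop :=
  ∀ ε : ℝ, 0 < ε → ∃ M₀ : ℕ, ∀ M : ℕ, M₀ ≤ M → ∃ (T : ℕ) (P : ℝ≥0), 0 < P ∧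
    ExistsCode S W c T M P ε ∧ (R : ℝ) ≤ Real.logb 2 M / P

/-- Capacity per unit cost: the supremum in `[0, ∞]` of the achievable rates per unit cost. -/
noncomputable def capacityPerUnitCost {X Y : Type*} [MeasurableSpace Y] (S : PMF ℕ)
    (W : X → PMF Y) (c : X → ℝ≥0) : ℝ≥0∞ :=
  ⨆ (R : ℝ≥0) (_ : Achievable S W c R), (R : ℝ≥0∞)

/-- Kullback-Leibler divergence in bits. -/
noncomputable def divBits {Y : Type*} [MeasurableSpace Y] (p q : PMF Y) : ℝ≥0∞ :=
  InformationTheory.klDiv p.toMeasure q.toMeasure / ENNReal.ofReal (Real.log 2)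

end IndelChannel

namespace IndelChannel

/-! Lower bound: use pulse position modulation. A message is a block of `n ≈ log M / R` copies of
one symbol `x`, placed at one of `M` positions in a stream of zeros. The spacing `d` is of order
`M`, so the input has length of order `M²` and the timing drift at the pulse has standard deviation
of order at most `M`. The decoder therefore has to search `O(M)` starting points per message,
`O(M²)` in all. By Stein's lemma (`exists_test`) a window of about `nμ` output symbols gives a false
alarm with probability about `exp(-nμD)`, where `D` is the divergence in nats. The union bound
succeeds when `2 log M < nμD`, that is `2R < μD`; the `M²` windows cause the factor `1/2`. See
`pulseCode_errorProb_le` and `eventually_existsCode`.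

Upper bound: fix the states and compare the output law with that of the all-zero input.
`mul_measure_pi_le` with `L = log M` bounds `log M` times the probability of correct decoding by a
divergence plus `M` times the probability of the decoding set under the zero input. Averaged over
messages, the last term is at most `1`, since the decoding sets are disjoint. The divergence counts
each input symbol once per repetition, so its mean is at most `μ` times the sum of the symbol
divergences, hence proportional to the cost (`Code.log_le`). -/

/-! ### Concentration and product measures -/

/-- Chebyshev's inequality for a partial sum of i.i.d. coordinates. -/
theorem pi_abs_sum_sub_ge_le {ι Ω : Type*} [Fintype ι] [MeasurableSpace Ω] (ν : Measure Ω)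
    [IsProbabilityMeasure ν] {f : Ω → ℝ} (hf : MemLp f 2 ν) (I : Finset ι) {r : ℝ} (hr : 0 < r) :
    (Measure.pi fun _ : ι => ν) {ω | r ≤ |∑ i ∈ I, f (ω i) - I.card * ∫ y, f y ∂ν|} ≤
      ENNReal.ofReal (I.card * variance f ν / r ^ 2) := by
  classical
  -- Coordinates outside `I` carry the zero function, so that the variance formula for sums over the
  -- whole index type applies.
  have hX : ∀ i, MemLp (if i ∈ I then f else 0) 2 ν := by
    intro i
    split_ifs
    · exact hf
    · exact MemLp.zero
  have hsum : ∀ ω : ι → Ω, (∑ i, fun ω : ι → Ω => (if i ∈ I then f else 0) (ω i)) ω =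
      ∑ i ∈ I, f (ω i) := by
    intro ω
    rw [Finset.sum_apply]
    simp only [ite_apply, Pi.zero_apply, Finset.sum_ite_mem, Finset.univ_inter]
  have hmem : ∀ i, MemLp (fun ω : ι → Ω => (if i ∈ I then f else 0) (ω i)) 2
      (Measure.pi fun _ : ι => ν) := fun i =>
    (hX i).comp_measurePreserving (measurePreserving_eval _ i)
  have hmean : ∫ ω, (∑ i, fun ω : ι → Ω => (if i ∈ I then f else 0) (ω i)) ω
      ∂(Measure.pi fun _ : ι => ν) = I.card * ∫ y, f y ∂ν := by
    simp_rw [hsum]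
    rw [integral_finsetSum]
    · rw [Finset.sum_congr rfl fun i _ =>
        integral_comp_eval (μ := fun _ : ι => ν) (i := i) hf.aestronglyMeasurable]
      simp
    · intro i _
      exact integrable_comp_eval (μ := fun _ : ι => ν) (hf.integrable (by norm_num))
  have h := meas_ge_le_variance_div_sq
    (μ := Measure.pi fun _ : ι => ν) (memLp_finsetSum' Finset.univ fun i _ => hmem i) hr
  rw [variance_sum_pi hX, hmean] at h
  simp_rw [hsum] at h
  refine h.trans_eq ?_
  congr 2
  have hvar : ∀ i, Var[if i ∈ I then f else 0; ν] = if i ∈ I then Var[f; ν] else 0 := by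
    intro i
    split_ifs
    · rfl
    · exact variance_zero ν
  simp [hvar]

/-- Chernoff's inequality for a sum of i.i.d. coordinates. -/
theorem pi_sum_ge_le {ι Ω : Type*} [Fintype ι] [MeasurableSpace Ω] (ν : Measure Ω)
    [IsProbabilityMeasure ν] {f : Ω → ℝ} (hf : Measurable f) (hb : ∃ B, ∀ y, |f y| ≤ B) (t : ℝ) :
    (Measure.pi fun _ : ι => ν) {ω | t ≤ ∑ i, f (ω i)} ≤
      ENNReal.ofReal (Real.exp (-t) * (∫ y, Real.exp (f y) ∂ν) ^ Fintype.card ι) := by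
  obtain ⟨B, hB⟩ := hb
  have hint : Integrable (fun y => Real.exp (f y)) ν :=
    Integrable.of_bound (by fun_prop) (Real.exp B) (ae_of_all _ fun y => by
      rw [Real.norm_eq_abs, Real.abs_exp]
      exact Real.exp_le_exp.2 ((le_abs_self _).trans (hB y)))
  have h := measure_ge_le_exp_mul_mgf (μ := Measure.pi fun _ : ι => ν)
    (X := fun ω => ∑ i, f (ω i)) (t := 1) t zero_le_one (by
      simp_rw [one_mul, Real.exp_sum]
      exact Integrable.fintype_prod (f := fun (_ : ι) y => Real.exp (f y)) fun _ => hint)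
  rw [mgf] at h
  simp_rw [one_mul, neg_one_mul, Real.exp_sum] at h
  rw [integral_fintype_prod_eq_pow (ι := ι) (fun y => Real.exp (f y))] at h
  rw [← ofReal_measureReal]
  exact ENNReal.ofReal_le_ofReal h

/-- The coordinates of a product measure along an injection have a product law. -/
theorem pi_map_comp_injective {ι κ Ω : Type*} [Fintype ι] [Fintype κ] [MeasurableSpace Ω]
    (ν : ι → Measure Ω) [∀ i, IsProbabilityMeasure (ν i)] {e : κ → ι} (he : Function.Injective e) :
    (Measure.pi ν).map (fun ω j => ω (e j)) = Measure.pi fun j => ν (e j) := by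
  have h : iIndepFun (fun i (ω : ι → Ω) => ω i) (Measure.pi ν) :=
    iIndepFun_pi (X := fun _ y => y) fun i => aemeasurable_id
  have h2 := (iIndepFun_iff_map_fun_eq_pi_map
    (fun j => (measurable_pi_apply (e j)).aemeasurable)).1 (h.precomp he)
  rw [show (fun (ω : ι → Ω) j => ω (e j)) = fun ω j => ((fun i (ω : ι → Ω) => ω i) ∘ e) j ω from rfl]
  refine h2.trans ?_
  congr 1
  ext1 j
  exact (measurePreserving_eval ν (e j)).map_eq

/-! ### Bounded test functions and Stein's lemma -/

/-- The truncation of `r` to `[1/(n+1), n+1]`. -/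
noncomputable def truncRatio (n : ℕ) (r : ℝ) : ℝ := max (1 / ((n : ℝ) + 1)) (min r (n + 1))

theorem truncRatio_pos (n : ℕ) (r : ℝ) : 0 < truncRatio n r :=
  lt_max_of_lt_left (by positivity)

theorem truncRatio_le (n : ℕ) (r : ℝ) : truncRatio n r ≤ n + 1 := by
  refine max_le ?_ (min_le_right _ _)
  rw [div_le_iff₀ (by positivity)]
  nlinarith [n.cast_nonneg (α := ℝ)]

theorem le_truncRatio (n : ℕ) (r : ℝ) : 1 / ((n : ℝ) + 1) ≤ truncRatio n r := le_max_left _ _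

theorem abs_log_truncRatio_le (n : ℕ) (r : ℝ) :
    |Real.log (truncRatio n r)| ≤ Real.log (n + 1) := by
  rw [abs_le, neg_le, ← Real.log_inv]
  refine ⟨Real.log_le_log (inv_pos.2 (truncRatio_pos n r)) ?_,
    Real.log_le_log (truncRatio_pos n r) (truncRatio_le n r)⟩
  have := inv_anti₀ (by positivity) (le_truncRatio n r)
  simpa using this

theorem measurable_truncRatio (n : ℕ) : Measurable (truncRatio n) := by
  unfold truncRatio
  fun_prop

theorem tendsto_truncRatio {r : ℝ} (hr : 0 ≤ r) :
    Filter.Tendsto (fun n => truncRatio n r) Filter.atTop (nhds r) := by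
  have h1 : Filter.Tendsto (fun n : ℕ => min r ((n : ℝ) + 1)) Filter.atTop (nhds r) := by
    refine tendsto_const_nhds.congr' ?_
    filter_upwards [Filter.eventually_ge_atTop ⌈r⌉₊] with n hn
    exact (min_eq_left (by linarith [Nat.ceil_le.1 hn])).symm
  have h2 := (tendsto_one_div_add_atTop_nhds_zero_nat (𝕜 := ℝ)).max h1
  rwa [max_eq_right hr] at h2

/-- The truncation interval contains `1`, so the truncated value `c` is either `1` or lies between
`1` and `r`; hence `(r - c) log c ≥ 0`, and what remains is `c log c - c + 1 ≥ 0`. This sign is what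
lets Fatou's lemma be used below. -/
theorem mul_log_truncRatio_nonneg (n : ℕ) (r : ℝ) :
    0 ≤ r * Real.log (truncRatio n r) - truncRatio n r + 1 := by
  set c := truncRatio n r with hc
  have hcpos : 0 < c := truncRatio_pos n r
  have hkl : 0 ≤ c * Real.log c + 1 - c := InformationTheory.klFun_nonneg hcpos.le
  suffices h : c * Real.log c ≤ r * Real.log c by linarith
  have hn : 1 / ((n : ℝ) + 1) ≤ 1 := by
    rw [div_le_iff₀ (by positivity)]
    linarith [n.cast_nonneg (α := ℝ)]
  rcases eq_or_ne c 1 with h0 | h0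
  · simp [h0]
  rcases le_total 1 c with h1 | h1
  · refine mul_le_mul_of_nonneg_right ?_ (Real.log_nonneg h1)
    rcases le_total (min r ((n : ℝ) + 1)) (1 / ((n : ℝ) + 1)) with h2 | h2
    · exact absurd (((max_eq_left h2).trans_le hn).antisymm h1) h0
    · exact (max_eq_right h2).trans_le (min_le_left _ _)
  · refine mul_le_mul_of_nonpos_right ?_ (Real.log_nonpos hcpos.le h1)
    rcases le_total r ((n : ℝ) + 1) with h2 | h2
    · exact (min_eq_left h2).symm.trans_le (le_max_right _ _)
    · have : (n : ℝ) + 1 ≤ c := (min_eq_right h2).symm.trans_le (le_max_right _ _)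
      exact absurd (h1.antisymm (by linarith [n.cast_nonneg (α := ℝ)])) h0

/-- The Donsker-Varadhan bound is approached by bounded functions, even if the divergence is
infinite. -/
theorem exists_bounded_add_integral_exp_sub_one_lt {Ω : Type*} [MeasurableSpace Ω]
    (P Q : Measure Ω) [IsProbabilityMeasure P] [IsProbabilityMeasure Q] {d : ℝ} (hd : 0 ≤ d)
    (h : ENNReal.ofReal d < InformationTheory.klDiv P Q) :
    ∃ f : Ω → ℝ, Measurable f ∧ (∃ B, ∀ y, |f y| ≤ B) ∧
      d + ∫ y, (Real.exp (f y) - 1) ∂Q < ∫ y, f y ∂P := by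
  by_cases hac : P ≪ Q
  · have hlim : ∀ y, Filter.Tendsto (fun n => ENNReal.ofReal
        ((P.rnDeriv Q y).toReal * Real.log (truncRatio n (P.rnDeriv Q y).toReal)
          - truncRatio n (P.rnDeriv Q y).toReal + 1)) Filter.atTop
        (nhds (ENNReal.ofReal (InformationTheory.klFun (P.rnDeriv Q y).toReal))) := by
      intro y
      refine ENNReal.tendsto_ofReal ?_
      have ht := tendsto_truncRatio (ENNReal.toReal_nonneg (a := P.rnDeriv Q y))
      set r := (P.rnDeriv Q y).toReal
      rw [show InformationTheory.klFun r = r * Real.log r - r + 1 by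
        rw [InformationTheory.klFun_apply]; ring]
      refine (Filter.Tendsto.sub ?_ ht).add_const 1
      rcases eq_or_ne r 0 with h0 | h0
      · simp [h0]
      · exact (ht.log h0).const_mul r
    have hmeas : ∀ n, Measurable fun y =>
        truncRatio n (P.rnDeriv Q y).toReal := fun n =>
      (measurable_truncRatio n).comp (P.measurable_rnDeriv Q).ennreal_toReal
    have hr := (P.measurable_rnDeriv Q).ennreal_toReal
    have hmeas2 : ∀ n, Measurable fun y => ENNReal.ofReal
        ((P.rnDeriv Q y).toReal * Real.log (truncRatio n (P.rnDeriv Q y).toReal)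
          - truncRatio n (P.rnDeriv Q y).toReal + 1) := fun n =>
      (((hr.mul (hmeas n).log).sub (hmeas n)).add_const 1).ennreal_ofReal
    obtain ⟨n, hn⟩ : ∃ n, ENNReal.ofReal d < ∫⁻ y, ENNReal.ofReal
        ((P.rnDeriv Q y).toReal * Real.log (truncRatio n (P.rnDeriv Q y).toReal)
          - truncRatio n (P.rnDeriv Q y).toReal + 1) ∂Q := by
      -- If no truncation exceeded `d`, Fatou's lemma would bound the divergence itself by `d`;
      -- finiteness of the divergence plays no role.
      by_contra! hcon
      refine h.not_ge ?_
      rw [InformationTheory.klDiv_eq_lintegral_klFun_of_ac hac]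
      simp_rw [← fun y => (hlim y).liminf_eq]
      refine (lintegral_liminf_le hmeas2).trans ?_
      refine (Filter.liminf_le_liminf (v := fun _ => ENNReal.ofReal d)
        (Filter.Eventually.of_forall hcon)).trans ?_
      simp
    have hb : ∀ y, |Real.log (truncRatio n (P.rnDeriv Q y).toReal)| ≤ Real.log (n + 1) :=
      fun y => abs_log_truncRatio_le n _
    have hexp : ∀ y, Real.exp (Real.log (truncRatio n (P.rnDeriv Q y).toReal)) =
      truncRatio n (P.rnDeriv Q y).toReal := fun y => Real.exp_log (truncRatio_pos n _)
    refine ⟨fun y => Real.log (truncRatio n (P.rnDeriv Q y).toReal), (hmeas n).log, ⟨_, hb⟩, ?_⟩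
    have hi1 : Integrable (fun y => (P.rnDeriv Q y).toReal *
        Real.log (truncRatio n (P.rnDeriv Q y).toReal)) Q :=
      Measure.integrable_toReal_rnDeriv.mul_bdd (hmeas n).log.aestronglyMeasurable
        (ae_of_all _ hb)
    have hi2 : Integrable (fun y => truncRatio n (P.rnDeriv Q y).toReal) Q :=
      Integrable.of_bound (hmeas n).aestronglyMeasurable ((n : ℝ) + 1) (ae_of_all _ fun y => by
        rw [Real.norm_eq_abs, abs_of_pos (truncRatio_pos n _)]
        exact truncRatio_le n _)
    have hi3 : Integrable (fun y => truncRatio n (P.rnDeriv Q y).toReal - 1) Q :=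
      hi2.sub (integrable_const 1)
    rw [← integral_rnDeriv_smul hac]
    simp_rw [hexp, smul_eq_mul]
    have hi4 : Integrable (fun y => (P.rnDeriv Q y).toReal *
        Real.log (truncRatio n (P.rnDeriv Q y).toReal)
          - truncRatio n (P.rnDeriv Q y).toReal + 1) Q := (hi1.sub hi2).add (integrable_const 1)
    rw [← ofReal_integral_eq_lintegral_ofReal hi4
      (ae_of_all _ fun y => mul_log_truncRatio_nonneg n _),
      ENNReal.ofReal_lt_ofReal_iff_of_nonneg hd] at hn
    have : ∫ y, ((P.rnDeriv Q y).toReal * Real.log (truncRatio n (P.rnDeriv Q y).toReal)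
          - truncRatio n (P.rnDeriv Q y).toReal + 1) ∂Q =
        ∫ y, (P.rnDeriv Q y).toReal * Real.log (truncRatio n (P.rnDeriv Q y).toReal) ∂Q -
        ∫ y, (truncRatio n (P.rnDeriv Q y).toReal - 1) ∂Q := by
      rw [← integral_sub hi1 hi3]
      congr 1
      ext y
      ring
    linarith
  · have : ∃ A, MeasurableSet A ∧ Q A = 0 ∧ P A ≠ 0 := by
      by_contra! hcon
      exact hac (Measure.AbsolutelyContinuous.mk hcon)
    obtain ⟨A, hA, hQ, hP⟩ := this
    have hPr : 0 < P.real A := ENNReal.toReal_pos hP (measure_ne_top P A)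
    -- A function supported on a `Q`-null set has no exponential cost, and this height gives it
    -- `P`-mean `d + 1`.
    refine ⟨A.indicator fun _ => (d + 1) / P.real A, measurable_const.indicator hA,
      ⟨|(d + 1) / P.real A|, fun y => ?_⟩, ?_⟩
    · by_cases hy : y ∈ A <;> simp [hy]
    · rw [integral_indicator_const _ hA, smul_eq_mul, mul_div_cancel₀ _ hPr.ne']
      have h0 : ∫ y, (Real.exp (A.indicator (fun _ => (d + 1) / P.real A) y) - 1) ∂Q = 0 := by
        refine integral_eq_zero_of_ae ?_
        filter_upwards [measure_eq_zero_iff_ae_notMem.1 hQ] with y hy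
        simp [hy]
      linarith

/-- Achievability part of Stein's lemma. -/
theorem exists_test {Ω : Type*} [MeasurableSpace Ω] (P Q : Measure Ω) [IsProbabilityMeasure P]
    [IsProbabilityMeasure Q] {d : ℝ} (hd : 0 ≤ d)
    (h : ENNReal.ofReal d < InformationTheory.klDiv P Q) {ε : ℝ} (hε : 0 < ε) :
    ∃ k₀ : ℕ, ∀ k ≥ k₀, ∃ A : Set (Fin k → Ω), MeasurableSet A ∧
      (Measure.pi fun _ : Fin k => P) Aᶜ ≤ ENNReal.ofReal ε ∧
      (Measure.pi fun _ : Fin k => Q) A ≤ ENNReal.ofReal (Real.exp (-(k * d))) := by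
  obtain ⟨f, hf, ⟨B, hB⟩, hlt⟩ := exists_bounded_add_integral_exp_sub_one_lt P Q hd h
  set b := ∫ y, (Real.exp (f y) - 1) ∂Q with hb
  set m := ∫ y, f y ∂P with hm
  have hg : 0 < m - (d + b) := by linarith
  have hmem : MemLp f 2 P := MemLp.of_bound hf.aestronglyMeasurable B (ae_of_all _ hB)
  -- The threshold `k(d + b)` is linearly below the `P`-mean `km`, so Chebyshev controls misses.
  -- Under `Q`, Chernoff gives `exp(-k(d + b)) (1 + b)^k ≤ exp(-kd)`.
  refine ⟨max 1 ⌈variance f P / ((m - (d + b)) ^ 2 * ε)⌉₊, fun k hk =>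
    ⟨{y | k * (d + b) ≤ ∑ i, f (y i)}, ?_, ?_, ?_⟩⟩
  · exact measurableSet_le measurable_const (by fun_prop)
  · have hk1 : (1 : ℝ) ≤ k := by exact_mod_cast (le_max_left _ _).trans hk
    have hk2 := Nat.ceil_le.1 ((le_max_right _ _).trans hk)
    have hr : 0 < k * (m - (d + b)) := by positivity
    refine (measure_mono ?_).trans ((pi_abs_sum_sub_ge_le P hmem Finset.univ hr).trans
      (ENNReal.ofReal_le_ofReal ?_))
    · intro y hy
      simp only [Set.mem_compl_iff, Set.mem_ofPred_eq, not_le] at hy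
      rw [Set.mem_ofPred_eq, Finset.card_univ, Fintype.card_fin, ← hm]
      refine le_trans ?_ (neg_le_abs _)
      linarith
    · rw [Finset.card_univ, Fintype.card_fin]
      rw [div_le_iff₀ (by positivity)] at hk2 ⊢
      nlinarith
  · refine (pi_sum_ge_le Q hf ⟨B, hB⟩ _).trans (ENNReal.ofReal_le_ofReal ?_)
    have hint : Integrable (fun y => Real.exp (f y)) Q :=
      Integrable.of_bound (by fun_prop) (Real.exp B) (ae_of_all _ fun y => by
        rw [Real.norm_eq_abs, Real.abs_exp]
        exact Real.exp_le_exp.2 ((le_abs_self _).trans (hB y)))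
    have h1 : ∫ y, Real.exp (f y) ∂Q = b + 1 := by
      rw [hb, integral_sub hint (integrable_const 1)]
      simp
    have h0 : 0 ≤ ∫ y, Real.exp (f y) ∂Q := integral_nonneg fun y => (Real.exp_pos _).le
    have h2 : (∫ y, Real.exp (f y) ∂Q) ^ k ≤ Real.exp b ^ k :=
      pow_le_pow_left₀ h0 (h1.trans_le (Real.add_one_le_exp b)) k
    rw [Fintype.card_fin]
    calc _ ≤ Real.exp (-(k * (d + b))) * Real.exp b ^ k := by gcongr
      _ = Real.exp (-(k * d)) := by
        rw [← Real.exp_nat_mul, ← Real.exp_add]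
        congr 1
        ring

/-! ### Change of measure for product laws -/

/-- Converse bound for a product measure: a weak form of the variational formula for the
divergence, evaluated at a multiple of an indicator. -/
theorem mul_measure_pi_le {Y ι : Type*} [Fintype ι] [Countable Y] [MeasurableSpace Y]
    [DiscreteMeasurableSpace Y] (P Q : ι → Measure Y) [∀ i, IsProbabilityMeasure (P i)]
    [∀ i, IsProbabilityMeasure (Q i)] (A : Set (ι → Y)) {L : ℝ} (hL : 0 ≤ L) :
    ENNReal.ofReal L * Measure.pi P A ≤ ∑ i, InformationTheory.klDiv (P i) (Q i) +
      ENNReal.ofReal (Real.exp L) * Measure.pi Q A := by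
  by_cases htop : ∑ i, InformationTheory.klDiv (P i) (Q i) = ∞
  · simp [htop]
  have hfin : ∀ i, P i ≪ Q i ∧ Integrable (llr (P i) (Q i)) (P i) := fun i =>
    InformationTheory.klDiv_ne_top_iff.1 ((ENNReal.sum_ne_top.1 htop) i (Finset.mem_univ i))
  have hkl : ∀ i, InformationTheory.klDiv (P i) (Q i) =
      ENNReal.ofReal (∫ y, llr (P i) (Q i) y ∂(P i)) := fun i => by
    rw [← InformationTheory.toReal_klDiv_of_measure_eq (hfin i).1 (by simp),
      ENNReal.ofReal_toReal ((ENNReal.sum_ne_top.1 htop) i (Finset.mem_univ i))]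
  -- Only an inequality: `Q i` may charge points that `P i` does not.
  have hpt : ∀ i y, P i {y} * ENNReal.ofReal (Real.exp (-llr (P i) (Q i) y)) ≤ Q i {y} := by
    intro i y
    have h1 : P i {y} = (P i).rnDeriv (Q i) y * Q i {y} := by
      conv_lhs => rw [← Measure.withDensity_rnDeriv_eq _ _ (hfin i).1]
      rw [withDensity_apply _ (measurableSet_singleton y), lintegral_singleton]
    rcases eq_or_ne (P i {y}) 0 with h0 | h0
    · simp [h0]
    have hr0 : (P i).rnDeriv (Q i) y ≠ 0 := fun h => h0 (by rw [h1, h, zero_mul])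
    have hq0 : Q i {y} ≠ 0 := fun h => h0 (by rw [h1, h, mul_zero])
    have hrt : (P i).rnDeriv (Q i) y ≠ ∞ := fun h =>
      measure_ne_top (P i) {y} (by rw [h1, h, ENNReal.top_mul hq0])
    have hpos := ENNReal.toReal_pos hr0 hrt
    rw [llr, ← Real.log_inv, Real.exp_log (inv_pos.2 hpos), ENNReal.ofReal_inv_of_pos hpos,
      ENNReal.ofReal_toReal hrt, h1, mul_comm, ← mul_assoc, ENNReal.inv_mul_cancel hr0 hrt, one_mul]
  have hA : MeasurableSet A := A.to_countable.measurableSet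
  -- With `a = L·1_A` and `G` the log-likelihood ratio, integrate `1 + u ≤ exp u` at `u = a - G`
  -- under the first law; changing measure bounds the right side by `1 + exp(L) Q(A)`.
  set G : (ι → Y) → ℝ := fun y => ∑ i, llr (P i) (Q i) (y i) with hG
  set a : (ι → Y) → ℝ := A.indicator fun _ => L with ha
  have hGi : Integrable G (Measure.pi P) := integrable_finsetSum _ fun i _ =>
    integrable_comp_eval (hfin i).2
  have hai : Integrable a (Measure.pi P) := (integrable_const L).indicator hA
  have hle : ∫⁻ y, ENNReal.ofReal (Real.exp (a y - G y)) ∂(Measure.pi P) ≤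
      1 + ENNReal.ofReal (Real.exp L) * Measure.pi Q A := by
    calc _ ≤ ∫⁻ y, ENNReal.ofReal (Real.exp (a y)) ∂(Measure.pi Q) := by
          rw [lintegral_countable', lintegral_countable']
          refine ENNReal.tsum_le_tsum fun y => ?_
          rw [sub_eq_add_neg, Real.exp_add, ENNReal.ofReal_mul (Real.exp_pos _).le, mul_assoc]
          gcongr
          rw [Measure.pi_singleton, Measure.pi_singleton, hG, ← Finset.sum_neg_distrib,
            Real.exp_sum, ENNReal.ofReal_prod_of_nonneg fun _ _ => (Real.exp_pos _).le,
            ← Finset.prod_mul_distrib]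
          refine Finset.prod_le_prod' fun i _ => ?_
          rw [mul_comm]
          exact hpt i (y i)
      _ ≤ ∫⁻ y, (1 + A.indicator (fun _ => ENNReal.ofReal (Real.exp L)) y) ∂(Measure.pi Q) := by
          refine lintegral_mono fun y => ?_
          by_cases hy : y ∈ A <;> simp [ha, hy]
      _ = _ := by
          rw [lintegral_add_left measurable_const, lintegral_indicator_const hA]
          simp
  have hei : Integrable (fun y => Real.exp (a y - G y)) (Measure.pi P) := by
    refine ⟨(Real.measurable_exp.comp_aemeasurable
      (hai.sub hGi).aemeasurable).aestronglyMeasurable, ?_⟩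
    rw [hasFiniteIntegral_iff_ofReal (ae_of_all _ fun _ => (Real.exp_pos _).le)]
    exact hle.trans_lt (by finiteness)
  have hmain : ∫ y, (a y - G y + 1) ∂(Measure.pi P) ≤ ∫ y, Real.exp (a y - G y) ∂(Measure.pi P) :=
    integral_mono ((hai.sub hGi).add (integrable_const 1)) hei fun y => Real.add_one_le_exp _
  have hea : ∫ y, Real.exp (a y - G y) ∂(Measure.pi P) ≤
      1 + Real.exp L * (Measure.pi Q).real A := by
    rw [integral_eq_lintegral_of_nonneg_ae (ae_of_all _ fun _ => (Real.exp_pos _).le)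
      hei.aestronglyMeasurable]
    refine ENNReal.toReal_le_of_le_ofReal (by positivity) (hle.trans_eq ?_)
    rw [ENNReal.ofReal_add zero_le_one (by positivity), ENNReal.ofReal_mul (Real.exp_pos _).le,
      ofReal_measureReal, ENNReal.ofReal_one]
  have hGint : ∫ y, G y ∂(Measure.pi P) = ∑ i, ∫ y, llr (P i) (Q i) y ∂(P i) := by
    rw [hG, integral_finsetSum _ fun i _ => integrable_comp_eval (hfin i).2]
    exact Finset.sum_congr rfl fun i _ => integral_comp_eval (hfin i).2.aestronglyMeasurable
  have hsub : Integrable (fun y => a y - G y) (Measure.pi P) := hai.sub hGi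
  rw [integral_add hsub (integrable_const 1), integral_sub hai hGi, hGint,
    integral_indicator_const _ hA] at hmain
  simp only [smul_eq_mul, integral_const, probReal_univ, mul_one] at hmain
  have hfinal : L * (Measure.pi P).real A ≤ ∑ i, ∫ y, llr (P i) (Q i) y ∂(P i) +
      Real.exp L * (Measure.pi Q).real A := by linarith
  have := ENNReal.ofReal_le_ofReal hfinal
  rw [ENNReal.ofReal_mul hL, ofReal_measureReal] at this
  refine this.trans (ENNReal.ofReal_add_le.trans ?_)
  rw [ENNReal.ofReal_mul (Real.exp_pos _).le, ofReal_measureReal]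
  gcongr
  simp_rw [hkl]
  refine (ENNReal.ofReal_sum_of_nonneg fun i _ => ?_).le
  have := InformationTheory.integral_llr_add_sub_measure_univ_nonneg (hfin i).1 (hfin i).2
  simpa using this

/-! ### Sampling times and prefix sums -/

/-- Number of output symbols produced by the first `p` input symbols. -/
def prefixSum {T : ℕ} (s : Fin T → ℕ) (p : ℕ) : ℕ := 
  ∑ j ∈ Finset.univ.filter fun j : Fin T => (j : ℕ) < p, s j

theorem prefixSum_le {T : ℕ} (s : Fin T → ℕ) (p : ℕ) : prefixSum s p ≤ ∑ t, s t :=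
  Finset.sum_le_sum_of_subset (Finset.filter_subset _ _)

theorem prefixSum_add_one {T : ℕ} (s : Fin T → ℕ) (t : Fin T) :
    prefixSum s (t + 1) = prefixSum s t + s t := by
  have h : Finset.univ.filter (fun j : Fin T => (j : ℕ) < t + 1) =
      insert t (Finset.univ.filter fun j : Fin T => (j : ℕ) < t) := by
    ext j
    simp only [Finset.mem_filter, Finset.mem_univ, true_and, Finset.mem_insert, Fin.ext_iff]
    omega
  rw [prefixSum, h, Finset.sum_insert (by simp), add_comm, prefixSum]

/-- Cumulative sums are monotone and the sampling time is the first at which they exceed `l`. This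
turns comparisons of input times into comparisons of output positions. -/
theorem samplingTime_lt_iff {T : ℕ} (s : Fin T → ℕ) (l : Fin (∑ t, s t)) (p : ℕ) :
    (samplingTime s l : ℕ) < p ↔ (l : ℕ) < prefixSum s p := by
  constructor
  · intro h
    have hm := Finset.min'_mem _ (exists_samplingTime s l)
    refine (Finset.mem_filter.1 hm).2.trans_le (Finset.sum_le_sum_of_subset fun j hj => ?_)
    simp only [Finset.mem_filter, Finset.mem_univ, true_and]
    exact lt_of_le_of_lt (Fin.le_def.1 (Finset.mem_Iic.1 hj)) h
  · intro h
    by_contra! hp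
    obtain _ | q := p
    · simp [prefixSum] at h
    · have hq : q < T := hp.trans (samplingTime s l).2.le
      have h2 : samplingTime s l ≤ ⟨q, hq⟩ := by
        refine Finset.min'_le _ _ (Finset.mem_filter.2 ⟨Finset.mem_univ _, ?_⟩)
        convert! h using 1
        refine Finset.sum_congr ?_ fun _ _ => rfl
        ext j
        simp only [Finset.mem_Iic, Finset.mem_filter, Finset.mem_univ, true_and, Fin.le_def]
        omega
      have := Fin.le_def.1 h2
      simp only at this
      omega

/-- These output positions lie between two consecutive prefix sums, which differ by `s t`. -/
theorem card_samplingTime_eq_le {T : ℕ} (s : Fin T → ℕ) (t : Fin T) :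
    (Finset.univ.filter fun l => samplingTime s l = t).card ≤ s t := by
  have h : (Finset.univ.filter fun l => samplingTime s l = t).card ≤
      (Finset.Ico (prefixSum s t) (prefixSum s (t + 1))).card := by
    refine Finset.card_le_card_of_injOn (fun l => (l : ℕ)) (fun l hl => ?_)
      (Fin.val_injective.injOn)
    have hl' : samplingTime s l = t := by simpa using hl
    rw [Finset.mem_coe, Finset.mem_Ico, ← not_lt, ← samplingTime_lt_iff, ← samplingTime_lt_iff, hl']
    simp
  rwa [Nat.card_Ico, prefixSum_add_one, Nat.add_sub_cancel_left] at h

theorem sum_comp_samplingTime_le {T : ℕ} (s : Fin T → ℕ) (g : Fin T → ℝ≥0∞) :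
    ∑ l, g (samplingTime s l) ≤ ∑ t, s t * g t := by
  rw [← Finset.sum_fiberwise Finset.univ (samplingTime s)]
  refine Finset.sum_le_sum fun t _ => ?_
  rw [Finset.sum_congr rfl fun l hl => by rw [(Finset.mem_filter.1 hl).2], Finset.sum_const,
    nsmul_eq_mul]
  gcongr
  exact card_samplingTime_eq_le s t

instance {S : PMF ℕ} {T : ℕ} : IsProbabilityMeasure (stateLaw S T) := by
  unfold stateLaw
  infer_instance

instance {X Y : Type*} [MeasurableSpace Y] {W : X → PMF Y} {n : ℕ} {x : Fin n → X} :
    IsProbabilityMeasure (dmcLaw W x) := by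
  unfold dmcLaw
  infer_instance

theorem lintegral_state {S : PMF ℕ} {μ σ2 : ℝ} (hS : HasMeanVar S μ σ2) {T : ℕ} (t : Fin T) :
    ∫⁻ s, (s t : ℝ≥0∞) ∂(stateLaw S T) = ENNReal.ofReal μ := by
  have h1 : ∫⁻ s, (s t : ℝ≥0∞) ∂(stateLaw S T) = ∫⁻ k, (k : ℝ≥0∞) ∂S.toMeasure :=
    (measurePreserving_eval (fun _ : Fin T => S.toMeasure) t).lintegral_comp
      (f := fun k : ℕ => (k : ℝ≥0∞)) (Measurable.of_discrete)
  rw [h1, ← hS.mean, ofReal_integral_eq_lintegral_ofReal (hS.memLp.integrable (by norm_num))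
    (ae_of_all _ fun k => Nat.cast_nonneg k)]
  simp

theorem HasMeanVar.mean_nonneg {S : PMF ℕ} {μ σ2 : ℝ} (hS : HasMeanVar S μ σ2) : 0 ≤ μ :=
  hS.mean ▸ integral_nonneg fun k => Nat.cast_nonneg k

/-! ### Upper bound -/

section Converse

variable {X Y : Type*} [MeasurableSpace Y]

/-- The largest divergence per unit cost, in bits. -/
noncomputable def maxDivPerCost [Zero X] (W : X → PMF Y) (c : X → ℝ≥0) : ℝ≥0∞ :=
  ⨆ x : {x : X // x ≠ 0}, divBits (W x) (W 0) / (c x : ℝ≥0∞)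

/-- Keeping the factor `a` covers `a = 0` with an infinite supremum. Otherwise the supremum is
finite, which forces the divergence of any nonzero symbol of cost zero to vanish. -/
theorem mul_klDiv_le_of_ne_top [Zero X] {W : X → PMF Y} {c : X → ℝ≥0} {a : ℝ≥0∞}
    (h : a * maxDivPerCost W c ≠ ∞) (x : X) :
    a * InformationTheory.klDiv (W x).toMeasure (W 0).toMeasure ≤
      a * maxDivPerCost W c * ENNReal.ofReal (Real.log 2) * c x := by
  rcases eq_or_ne a 0 with ha | ha
  · simp [ha]
  have hK : maxDivPerCost W c ≠ ∞ := fun hK => h (by rw [hK, ENNReal.mul_top ha])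
  rcases eq_or_ne x 0 with hx | hx
  · simp [hx, InformationTheory.klDiv_self]
  have hlog : 0 < Real.log 2 := Real.log_pos one_lt_two
  have h1 : divBits (W x) (W 0) / (c x : ℝ≥0∞) ≤ maxDivPerCost W c :=
    le_iSup (fun x : {x : X // x ≠ 0} => divBits (W x) (W 0) / (c x : ℝ≥0∞)) ⟨x, hx⟩
  have h2 : divBits (W x) (W 0) ≤ maxDivPerCost W c * c x := by
    rcases eq_or_ne (c x : ℝ≥0∞) 0 with h0 | h0
    · rw [h0] at h1 ⊢
      by_cases hd : divBits (W x) (W 0) = 0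
      · simp [hd]
      · rw [ENNReal.div_zero hd] at h1
        exact absurd (top_le_iff.1 h1) hK
    · exact (ENNReal.div_le_iff h0 (by simp)).1 h1
  rw [divBits, ENNReal.div_le_iff (by simpa using hlog) (by simp)] at h2
  rw [mul_assoc, mul_assoc]
  gcongr
  rwa [mul_comm (ENNReal.ofReal _), ← mul_assoc]

/-- The expected divergence between the outputs for the input `x` and for the zero input is
at most proportional to the cost of `x`. -/
theorem lintegral_sum_klDiv_le [Zero X] {S : PMF ℕ} {μ σ2 : ℝ} (hS : HasMeanVar S μ σ2) {W : X → PMF Y}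
    {c : X → ℝ≥0} (h : ENNReal.ofReal μ * maxDivPerCost W c ≠ ∞) {T : ℕ} (x : Fin T → X) :
    ∫⁻ s, ∑ l, InformationTheory.klDiv (W (idcOutput x s l)).toMeasure (W 0).toMeasure
      ∂(stateLaw S T) ≤
    ENNReal.ofReal μ * maxDivPerCost W c * ENNReal.ofReal (Real.log 2) * (∑ t, c (x t) : ℝ≥0) := by
  calc _ ≤ ∫⁻ s, ∑ t, s t * InformationTheory.klDiv (W (x t)).toMeasure (W 0).toMeasure
        ∂(stateLaw S T) := lintegral_mono fun s => sum_comp_samplingTime_le s fun t =>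
          InformationTheory.klDiv (W (x t)).toMeasure (W 0).toMeasure
    _ = ∑ t, ENNReal.ofReal μ * InformationTheory.klDiv (W (x t)).toMeasure (W 0).toMeasure := by
      rw [lintegral_finsetSum _ fun _ _ => Measurable.of_discrete]
      refine Finset.sum_congr rfl fun t _ => ?_
      rw [lintegral_mul_const _ Measurable.of_discrete, lintegral_state hS]
    _ ≤ _ := by
      push_cast
      rw [Finset.mul_sum]
      exact Finset.sum_le_sum fun t _ => mul_klDiv_le_of_ne_top h (x t)

theorem Code.sum_decode_le [Countable Y] [DiscreteMeasurableSpace Y] {T M : ℕ} (C : Code X Y T M) {n : ℕ} (ν : Measure (Fin n → Y))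
    [IsProbabilityMeasure ν] : ∑ m, ν {y | C.decode n y = some m} ≤ 1 := by
  rw [← measure_biUnion_finset]
  · exact prob_le_one
  · intro m _ m' _ hmm
    refine Set.disjoint_left.2 fun y hy hy' => hmm ?_
    have : some m = some m' := hy.symm.trans hy'
    exact Option.some_injective _ this
  · exact fun m _ => (Set.to_countable _).measurableSet

/-- Fano-type inequality. -/
theorem Code.log_le [Zero X] [Countable Y]
    [DiscreteMeasurableSpace Y] {S : PMF ℕ} {μ σ2 : ℝ} (hS : HasMeanVar S μ σ2) {W : X → PMF Y}
    {c : X → ℝ≥0} (h : ENNReal.ofReal μ * maxDivPerCost W c ≠ ∞) {T M : ℕ} (hM : 1 ≤ M)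
    (C : Code X Y T M) {P : ℝ≥0} (hP : ∀ m, ∑ t, c (C.codeword m t) ≤ P) :
    ENNReal.ofReal (Real.log M) ≤ ENNReal.ofReal (Real.log M) * C.avgErrorProb S W +
      ENNReal.ofReal μ * maxDivPerCost W c * ENNReal.ofReal (Real.log 2) * P + 1 := by
  set L := ENNReal.ofReal (Real.log M) with hL
  obtain ⟨U, hU⟩ : ∃ U, U = ENNReal.ofReal μ * maxDivPerCost W c * ENNReal.ofReal (Real.log 2) * P :=
    ⟨_, rfl⟩
  rw [← hU]
  have hM0 : (0 : ℝ) < M := by exact_mod_cast hM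
  have hlog : 0 ≤ Real.log M := Real.log_nonneg (by exact_mod_cast hM)
  -- The choice `L = log M` makes the factor `exp L` equal to `M`.
  have h1 : ∀ m s, L ≤ L * dmcLaw W (idcOutput (C.codeword m) s)
        {y | C.decode (∑ t, s t) y ≠ some m} +
      (∑ l, InformationTheory.klDiv (W (idcOutput (C.codeword m) s l)).toMeasure (W 0).toMeasure +
      M * dmcLaw W (fun _ : Fin (∑ t, s t) => (0 : X)) {y | C.decode (∑ t, s t) y = some m}) := by
    intro m s
    have h2 := mul_measure_pi_le (fun l => (W (idcOutput (C.codeword m) s l)).toMeasure)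
      (fun _ => (W 0).toMeasure) {y | C.decode (∑ t, s t) y = some m} hlog
    rw [Real.exp_log hM0, ENNReal.ofReal_natCast] at h2
    refine le_trans ?_ (add_le_add_right h2 _)
    rw [← dmcLaw, ← hL, ← mul_add]
    refine le_mul_of_one_le_right zero_le ?_
    rw [← measure_univ (μ := dmcLaw W (idcOutput (C.codeword m) s))]
    refine (measure_mono fun y _ => ?_).trans (measure_union_le _ _)
    exact (em (C.decode (∑ t, s t) y = some m)).symm
  have h2 : ∀ m, L ≤ L * C.errorProb S W m + (U + M * ∫⁻ s, dmcLaw W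
      (fun _ : Fin (∑ t, s t) => (0 : X)) {y | C.decode (∑ t, s t) y = some m} ∂(stateLaw S T)) := by
    intro m
    calc L = ∫⁻ _, L ∂(stateLaw S T) := by simp
      _ ≤ _ := lintegral_mono (h1 m)
      _ = _ := by
        rw [lintegral_add_left Measurable.of_discrete, lintegral_add_left Measurable.of_discrete,
          lintegral_const_mul _ Measurable.of_discrete, lintegral_const_mul _ Measurable.of_discrete]
      _ ≤ _ := by
        rw [← Code.errorProb]
        gcongr
        refine (lintegral_sum_klDiv_le hS h _).trans ?_
        rw [hU]
        gcongr
        exact hP m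
  have h3 := Finset.sum_le_sum fun m (_ : m ∈ Finset.univ) => h2 m
  rw [Finset.sum_add_distrib, Finset.sum_add_distrib, ← Finset.mul_sum, ← Finset.mul_sum,
    ← lintegral_finsetSum _ fun _ _ => Measurable.of_discrete, Finset.sum_const, Finset.sum_const,
    Finset.card_univ, Fintype.card_fin, nsmul_eq_mul, nsmul_eq_mul] at h3
  -- The reference law depends on the states but not on the message, so for fixed states the
  -- disjoint decoding sets share total mass at most one.
  have h4 : ∫⁻ s, ∑ m, dmcLaw W (fun _ : Fin (∑ t, s t) => (0 : X))
      {y | C.decode (∑ t, s t) y = some m} ∂(stateLaw S T) ≤ 1 :=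
    (lintegral_mono fun s => C.sum_decode_le _).trans (by simp)
  have h5 : M * L ≤ M * (L * C.avgErrorProb S W + U + 1) := by
    refine h3.trans ?_
    have : L * ∑ m, C.errorProb S W m = M * (L * C.avgErrorProb S W) := by
      rw [Code.avgErrorProb, mul_left_comm, ENNReal.mul_div_cancel (by simp; omega) (by simp)]
    rw [this, mul_add, mul_add, mul_one, add_assoc]
    gcongr
    exact mul_le_of_le_one_right zero_le h4
  exact (ENNReal.mul_le_mul_iff_right (by simp; omega) (by simp)).1 h5

theorem capacityPerUnitCost_le [Zero X] [Countable Y]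
    [DiscreteMeasurableSpace Y] {S : PMF ℕ} {μ σ2 : ℝ} (hS : HasMeanVar S μ σ2) (W : X → PMF Y)
    (c : X → ℝ≥0) :
    capacityPerUnitCost S W c ≤ ENNReal.ofReal μ * maxDivPerCost W c := by
  refine iSup₂_le fun R hR => ?_
  by_contra! hlt
  have hU : ENNReal.ofReal μ * maxDivPerCost W c ≠ ∞ := hlt.ne_top
  set u := (ENNReal.ofReal μ * maxDivPerCost W c).toReal with hu
  have huR : u < R := by
    have := (ENNReal.toReal_lt_toReal hU ENNReal.coe_ne_top).2 hlt
    rwa [ENNReal.coe_toReal] at this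
  have hu0 : 0 ≤ u := ENNReal.toReal_nonneg
  have hR0 : (0 : ℝ) < R := hu0.trans_lt huR
  -- With this error level and `log M > 2R/(R - u)`, the error term and the additive `1` each
  -- account for at most half of the gap `R - u`, the second strictly less.
  obtain ⟨M₀, hM₀⟩ := hR ((R - u) / (2 * R)) (by have := sub_pos.2 huR; positivity)
  obtain ⟨N, hN⟩ := exists_nat_gt (Real.exp (2 * R / (R - u)))
  obtain ⟨M, hM₀M, hM1, hMN⟩ : ∃ M, M₀ ≤ M ∧ 1 ≤ M ∧ N ≤ M := ⟨M₀ + N + 1, by omega⟩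
  obtain ⟨T, P, hP, ⟨C, hC, herr⟩, hRP⟩ := hM₀ M hM₀M
  have hlog0 : 0 ≤ Real.log M := Real.log_nonneg (by exact_mod_cast hM1)
  have hlogM : 2 * R / (R - u) < Real.log M := by
    rw [Real.lt_log_iff_exp_lt (by exact_mod_cast hM1)]
    exact hN.trans_le (by exact_mod_cast hMN)
  have hlog2 : 0 < Real.log 2 := Real.log_pos one_lt_two
  have hε : 0 ≤ (R - u) / (2 * R) := by have := sub_pos.2 huR; positivity
  have h1 := C.log_le hS hU hM1 hC
  have h2 : ENNReal.ofReal (Real.log M) ≤ ENNReal.ofReal (Real.log M * ((R - u) / (2 * R)) +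
      u * Real.log 2 * P + 1) := by
    refine h1.trans ?_
    rw [ENNReal.ofReal_add (by positivity) zero_le_one, ENNReal.ofReal_add (by positivity)
      (by positivity), ENNReal.ofReal_mul hlog0, ENNReal.ofReal_mul (by positivity),
      ENNReal.ofReal_mul (by positivity), ENNReal.ofReal_one, hu, ENNReal.ofReal_toReal hU,
      ENNReal.ofReal_coe_nnreal]
    gcongr
  rw [ENNReal.ofReal_le_ofReal_iff (by positivity)] at h2
  have hP' : (0 : ℝ) < P := by exact_mod_cast hP
  rw [Real.logb, le_div_iff₀ hP', le_div_iff₀ hlog2] at hRP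
  rw [div_lt_iff₀ (by linarith)] at hlogM
  have h3 : R * Real.log M ≤ Real.log M * ((R - u) / 2) + u * Real.log M + R := by
    calc R * Real.log M ≤ R * (Real.log M * ((R - u) / (2 * R)) + u * Real.log 2 * P + 1) := by
          gcongr
      _ = Real.log M * ((R - u) / 2) + u * (R * P * Real.log 2) + R := by
          field_simp
      _ ≤ _ := by gcongr
  nlinarith

end Converse

/-! ### Blocks of states and windows of the output -/

/-- The number of output symbols produced by the `n` input symbols that start at `p`. -/
def blockSum {T : ℕ} (s : Fin T → ℕ) (p n : ℕ) : ℕ :=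
  ∑ j ∈ Finset.univ.filter fun j : Fin T => p ≤ (j : ℕ) ∧ (j : ℕ) < p + n, s j

theorem prefixSum_add {T : ℕ} (s : Fin T → ℕ) (p n : ℕ) :
    prefixSum s (p + n) = prefixSum s p + blockSum s p n := by
  unfold prefixSum blockSum
  rw [← Finset.sum_union]
  · refine Finset.sum_congr ?_ fun _ _ => rfl
    ext j
    simp only [Finset.mem_filter, Finset.mem_univ, true_and, Finset.mem_union]
    omega
  · rw [Finset.disjoint_filter]
    intro j _ h1 h2
    omega

theorem prefixSum_eq_blockSum {T : ℕ} (s : Fin T → ℕ) (p : ℕ) :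
    prefixSum s p = blockSum s 0 p := by
  simpa [prefixSum] using prefixSum_add s 0 p

theorem card_filter_block {T p n : ℕ} (h : p + n ≤ T) :
    (Finset.univ.filter fun j : Fin T => p ≤ (j : ℕ) ∧ (j : ℕ) < p + n).card = n := by
  have : (Finset.univ.filter fun j : Fin T => p ≤ (j : ℕ) ∧ (j : ℕ) < p + n).map Fin.valEmbedding =
      Finset.Ico p (p + n) := by
    ext a
    simp only [Finset.mem_map, Finset.mem_filter, Finset.mem_univ, true_and, Fin.valEmbedding_apply,
      Finset.mem_Ico]
    constructor
    · rintro ⟨j, hj, rfl⟩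
      exact hj
    · intro ha
      exact ⟨⟨a, by omega⟩, ha, rfl⟩
  rw [← Finset.card_map Fin.valEmbedding, this, Nat.card_Ico, Nat.add_sub_cancel_left]

theorem stateLaw_blockSum_ge_le {S : PMF ℕ} {μ σ2 : ℝ} (hS : HasMeanVar S μ σ2) {T p n : ℕ}
    (h : p + n ≤ T) {r : ℝ} (hr : 0 < r) :
    stateLaw S T {s | r ≤ |(blockSum s p n : ℝ) - n * μ|} ≤ ENNReal.ofReal (n * σ2 / r ^ 2) := by
  have := pi_abs_sum_sub_ge_le (ι := Fin T) S.toMeasure hS.memLp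
    (Finset.univ.filter fun j : Fin T => p ≤ (j : ℕ) ∧ (j : ℕ) < p + n) hr
  rw [card_filter_block h, hS.mean, hS.var] at this
  simpa [blockSum, stateLaw] using this

/-- The `k` consecutive symbols of `y` that start at position `a`. -/
def window {Y : Type*} {N a k : ℕ} (h : a + k ≤ N) (y : Fin N → Y) : Fin k → Y :=
  fun i => y ⟨a + i, by omega⟩

/-- A window fed by a single input value has i.i.d. coordinates, so the test `A` for product laws
applies to it. -/
theorem dmcLaw_window {X Y : Type*} [MeasurableSpace Y] (W : X → PMF Y) {N a k : ℕ}
    (h : a + k ≤ N) (x : Fin N → X) {v : X} (hx : ∀ l : Fin N, a ≤ l → (l : ℕ) < a + k → x l = v)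
    {A : Set (Fin k → Y)} (hA : MeasurableSet A) :
    dmcLaw W x {y | window h y ∈ A} = (Measure.pi fun _ : Fin k => (W v).toMeasure) A := by
  have he : Function.Injective fun i : Fin k => (⟨a + i, by omega⟩ : Fin N) := by
    intro i j hij
    have := congrArg Fin.val hij
    simp only at this
    ext
    omega
  have h1 := pi_map_comp_injective (fun l => (W (x l)).toMeasure) he
  have h2 : (fun j : Fin k => (W (x ⟨a + j, by omega⟩)).toMeasure) = fun _ => (W v).toMeasure := by
    funext j
    rw [hx _ (by simp) (by simp)]
  rw [h2] at h1
  rw [← h1, Measure.map_apply (measurable_pi_lambda _ fun j => measurable_pi_apply _) hA]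
  rfl

/-- The natural numbers at distance at most `w` from `v`. -/
noncomputable def nearby (v w : ℝ) : Finset ℕ := Finset.Icc ⌈v - w⌉₊ ⌊v + w⌋₊

theorem mem_nearby {v w : ℝ} (h : 0 ≤ v + w) {a : ℕ} : a ∈ nearby v w ↔ |(a : ℝ) - v| ≤ w := by
  rw [nearby, Finset.mem_Icc, Nat.ceil_le, Nat.le_floor_iff h, abs_le]
  constructor <;> rintro ⟨h1, h2⟩ <;> constructor <;> linarith

theorem card_nearby_le {v w : ℝ} (hv : 0 ≤ v + w) (hw : 0 ≤ w) :
    ((nearby v w).card : ℝ) ≤ 2 * w + 1 := by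
  rw [nearby, Nat.card_Icc]
  rcases le_total ⌈v - w⌉₊ (⌊v + w⌋₊ + 1) with h | h
  · rw [Nat.cast_sub h]
    push_cast
    linarith [Nat.le_ceil (v - w), Nat.floor_le hv]
  · rw [Nat.sub_eq_zero_of_le h]
    push_cast
    positivity

/-! ### Pulse position modulation -/

/-- Some window of `y` that starts near `v` belongs to `A`. -/
def Detected {Y : Type*} {k N : ℕ} (A : Set (Fin k → Y)) (v w : ℝ) (y : Fin N → Y) : Prop :=
  ∃ a ∈ nearby v w, ∃ h : a + k ≤ N, window h y ∈ A

open scoped Classical in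
/-- Pulse position modulation: the message `m` is sent as a block of `n` symbols `x` that starts at
time `m * d`. The decoder looks for the block near its mean position. -/
noncomputable def pulseCode {X Y : Type*} [Zero X] (x : X) (M n d : ℕ) {k : ℕ}
    (A : Set (Fin k → Y)) (μ w : ℝ) : Code X Y (M * d) M where
  codeword m t := if (m : ℕ) * d ≤ t ∧ (t : ℕ) < m * d + n then x else 0
  decode _ y := if h : ∃ m : Fin M, Detected A ((m * d : ℕ) * μ) w y then some h.choose else none

section PulseCode

variable {X Y : Type*} [Zero X] (x : X) {M n d k : ℕ} (A : Set (Fin k → Y)) (μ w : ℝ)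

theorem block_add_le (hnd : n ≤ d) (m : Fin M) : (m : ℕ) * d + n ≤ M * d :=
  calc (m : ℕ) * d + n ≤ m * d + d := by omega
    _ = (m + 1) * d := by ring
    _ ≤ M * d := Nat.mul_le_mul_right d m.2

theorem pulseCode_cost_le {c : X → ℝ≥0} (hc : c 0 = 0) (hnd : n ≤ d) (m : Fin M) :
    ∑ t, c ((pulseCode x M n d A μ w).codeword m t) ≤ n * c x := by
  have h : ∀ t : Fin (M * d), c ((pulseCode x M n d A μ w).codeword m t) =
      if (m : ℕ) * d ≤ t ∧ (t : ℕ) < m * d + n then c x else 0 := by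
    intro t
    simp only [pulseCode]
    split_ifs
    · rfl
    · exact hc
  simp_rw [h]
  rw [← Finset.sum_filter, Finset.sum_const, card_filter_block (block_add_le hnd m), nsmul_eq_mul]

/-- The decoder picks an arbitrary detected message, so uniqueness forces the choice. -/
theorem pulseCode_decode_eq {N : ℕ} {m : Fin M} {y : Fin N → Y}
    (h1 : Detected A ((m * d : ℕ) * μ) w y)
    (h2 : ∀ m' : Fin M, m' ≠ m → ¬ Detected A ((m' * d : ℕ) * μ) w y) :
    (pulseCode x M n d A μ w).decode N y = some m := by
  have h : ∃ m : Fin M, Detected A ((m * d : ℕ) * μ) w y := ⟨m, h1⟩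
  simp only [pulseCode]
  rw [dif_pos h]
  congr 1
  by_contra hne
  exact h2 _ hne h.choose_spec

theorem idcOutput_pulseCode_of_lt {m : Fin M} {s : Fin (M * d) → ℕ} {l : Fin (∑ t, s t)}
    (h : (l : ℕ) < prefixSum s (m * d)) :
    idcOutput ((pulseCode x M n d A μ w).codeword m) s l = 0 := by
  rw [← samplingTime_lt_iff] at h
  simp only [idcOutput, pulseCode]
  rw [if_neg (by omega)]

theorem idcOutput_pulseCode_of_ge {m : Fin M} {s : Fin (M * d) → ℕ} {l : Fin (∑ t, s t)}
    (h : prefixSum s (m * d + n) ≤ l) :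
    idcOutput ((pulseCode x M n d A μ w).codeword m) s l = 0 := by
  rw [← not_lt, ← samplingTime_lt_iff] at h
  simp only [idcOutput, pulseCode]
  rw [if_neg (by omega)]

theorem idcOutput_pulseCode_of_mem {m : Fin M} {s : Fin (M * d) → ℕ} {l : Fin (∑ t, s t)}
    (h1 : prefixSum s (m * d) ≤ l) (h2 : (l : ℕ) < prefixSum s (m * d + n)) :
    idcOutput ((pulseCode x M n d A μ w).codeword m) s l = x := by
  rw [← not_lt, ← samplingTime_lt_iff] at h1
  rw [← samplingTime_lt_iff] at h2
  simp only [idcOutput, pulseCode]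
  rw [if_pos (by omega)]

/-- Error probability of pulse position modulation given typical states. -/
theorem dmcLaw_pulseCode_le [MeasurableSpace Y] (W : X → PMF Y) {A : Set (Fin k → Y)}
    (hA : MeasurableSet A) {μ w : ℝ} (hμ : 0 ≤ μ) (hw : 0 ≤ w) {b : ℝ}
    (hd : 2 * w + b + k ≤ d * μ)
    (m : Fin M) {s : Fin (M * d) → ℕ}
    (hs : |(prefixSum s (m * d) : ℝ) - (m * d : ℕ) * μ| ≤ w)
    (hk : k ≤ blockSum s (m * d) n) (hb : blockSum s (m * d) n ≤ b) :
    dmcLaw W (idcOutput ((pulseCode x M n d A μ w).codeword m) s)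
        {y | (pulseCode x M n d A μ w).decode _ y ≠ some m} ≤
      (Measure.pi fun _ : Fin k => (W x).toMeasure) Aᶜ +
      ENNReal.ofReal (M * (2 * w + 1)) * (Measure.pi fun _ : Fin k => (W 0).toMeasure) A := by
  set B := prefixSum s (m * d) with hB
  set ν := dmcLaw W (idcOutput ((pulseCode x M n d A μ w).codeword m) s) with hν
  have hv : ∀ m : Fin M, 0 ≤ ((m * d : ℕ) : ℝ) * μ + w := fun m => by positivity
  have hE := prefixSum_add s (m * d) n
  rw [← hB] at hE
  have hBk : B + k ≤ ∑ t, s t :=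
    (by omega : B + k ≤ prefixSum s (m * d + n)).trans (prefixSum_le s _)
  have hb0 : 0 ≤ b := (Nat.cast_nonneg _).trans hb
  -- An error needs a miss in the window starting exactly at the pulse, or a detection in some
  -- window tested for another message.
  have hsub : {y | (pulseCode x M n d A μ w).decode _ y ≠ some m} ⊆
      {y | window hBk y ∈ Aᶜ} ∪ ⋃ m' ∈ Finset.univ.filter (fun m' : Fin M => m' ≠ m),
        ⋃ a ∈ nearby ((m' * d : ℕ) * μ) w, {y | ∃ h : a + k ≤ ∑ t, s t, window h y ∈ A} := by
    intro y hy
    by_contra hcon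
    simp only [Set.mem_union, Set.mem_ofPred_eq, Set.mem_compl_iff, not_or, not_not, Set.mem_iUnion,
      Finset.mem_filter, Finset.mem_univ, true_and] at hcon
    refine hy (pulseCode_decode_eq x A μ w ⟨B, (mem_nearby (hv m)).2 hs, hBk, hcon.1⟩ ?_)
    rintro m' hm' ⟨a, ha, h⟩
    exact hcon.2 ⟨m', hm', a, ha, h⟩
  have hfalse : ∀ m' : Fin M, m' ≠ m → ∀ a ∈ nearby ((m' * d : ℕ) * μ) w,
      ν {y | ∃ h : a + k ≤ ∑ t, s t, window h y ∈ A} ≤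
        (Measure.pi fun _ : Fin k => (W 0).toMeasure) A := by
    intro m' hm' a ha
    by_cases h : a + k ≤ ∑ t, s t
    · simp only [h, exists_true_left]
      refine (dmcLaw_window W h _ (fun l hl1 hl2 => ?_) hA).le
      rw [mem_nearby (hv m'), abs_le] at ha
      rw [abs_le] at hs
      push_cast at ha hs
      -- The spacing `dμ ≥ 2w + b + k` absorbs the drift at both positions, the pulse length and the
      -- window length: windows of earlier messages end before the pulse and those of later messages
      -- start after it, so they see only zeros.
      rcases lt_or_gt_of_ne hm' with hlt | hlt
      · have h1 : ((m' : ℕ) : ℝ) + 1 ≤ (m : ℕ) := by exact_mod_cast hlt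
        have h2 : (((m' : ℕ) : ℝ) + 1) * (d * μ) ≤ (m : ℕ) * (d * μ) := by gcongr
        have h3 : (a : ℝ) + k ≤ B := by nlinarith
        have h4 : a + k ≤ B := by exact_mod_cast h3
        exact idcOutput_pulseCode_of_lt x A μ w (by omega)
      · have h1 : ((m : ℕ) : ℝ) + 1 ≤ (m' : ℕ) := by exact_mod_cast hlt
        have h2 : (((m : ℕ) : ℝ) + 1) * (d * μ) ≤ (m' : ℕ) * (d * μ) := by gcongr
        have h3 : (B : ℝ) + blockSum s (m * d) n ≤ a := by
          nlinarith [k.cast_nonneg (α := ℝ)]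
        have h4 : B + blockSum s (m * d) n ≤ a := by exact_mod_cast h3
        exact idcOutput_pulseCode_of_ge x A μ w (by omega)
    · simp [h]
  refine (measure_mono hsub).trans ((measure_union_le _ _).trans (add_le_add ?_ ?_))
  · refine (dmcLaw_window W hBk _ (fun l hl1 hl2 => ?_) hA.compl).le
    exact idcOutput_pulseCode_of_mem x A μ w hl1 (by omega)
  · set q := (Measure.pi fun _ : Fin k => (W 0).toMeasure) A with hq
    calc _ ≤ ∑ m' ∈ Finset.univ.filter (fun m' : Fin M => m' ≠ m),
          ∑ a ∈ nearby ((m' * d : ℕ) * μ) w, q := by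
          refine (measure_biUnion_finset_le _ _).trans (Finset.sum_le_sum fun m' hm' => ?_)
          refine (measure_biUnion_finset_le _ _).trans (Finset.sum_le_sum fun a ha => ?_)
          exact hfalse m' (Finset.mem_filter.1 hm').2 a ha
      _ ≤ ∑ m' : Fin M, ENNReal.ofReal (2 * w + 1) * q := by
          refine (Finset.sum_le_sum_of_subset (Finset.filter_subset _ _)).trans
            (Finset.sum_le_sum fun m' _ => ?_)
          rw [Finset.sum_const, nsmul_eq_mul, ← ENNReal.ofReal_natCast]
          gcongr
          exact card_nearby_le (hv m') hw
      _ = _ := by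
          rw [Finset.sum_const, Finset.card_univ, Fintype.card_fin, nsmul_eq_mul,
            ENNReal.ofReal_mul (Nat.cast_nonneg _), ENNReal.ofReal_natCast, mul_assoc]

/-- Error probability of pulse position modulation. -/
theorem pulseCode_errorProb_le [MeasurableSpace Y] {S : PMF ℕ} {μ σ2 : ℝ} (hS : HasMeanVar S μ σ2)
    (W : X → PMF Y) {A : Set (Fin k → Y)} (hA : MeasurableSet A) {w r : ℝ} (hw : 0 < w)
    (hr : 0 < r) (hnd : n ≤ d) (hk : k ≤ n * μ - r) (hd : 2 * w + (n * μ + r) + k ≤ d * μ)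
    (m : Fin M) :
    (pulseCode x M n d A μ w).errorProb S W m ≤
      ENNReal.ofReal (M * d * σ2 / w ^ 2) + ENNReal.ofReal (n * σ2 / r ^ 2) +
      ((Measure.pi fun _ : Fin k => (W x).toMeasure) Aᶜ +
      ENNReal.ofReal (M * (2 * w + 1)) * (Measure.pi fun _ : Fin k => (W 0).toMeasure) A) := by
  set e := (Measure.pi fun _ : Fin k => (W x).toMeasure) Aᶜ +
      ENNReal.ofReal (M * (2 * w + 1)) * (Measure.pi fun _ : Fin k => (W 0).toMeasure) A with he
  have hσ : 0 ≤ σ2 := hS.var ▸ variance_nonneg _ _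
  -- Two atypical state events: too much drift before the pulse, and an abnormal number of outputs
  -- from the pulse. Only the drift at the true position matters, so no union over times is needed.
  set b1 := {s : Fin (M * d) → ℕ | w ≤ |(blockSum s 0 (m * d) : ℝ) - (m * d : ℕ) * μ|} with hb1
  set b2 := {s : Fin (M * d) → ℕ | r ≤ |(blockSum s (m * d) n : ℝ) - n * μ|} with hb2
  have hle : ∀ s, dmcLaw W (idcOutput ((pulseCode x M n d A μ w).codeword m) s)
        {y | (pulseCode x M n d A μ w).decode (∑ t, s t) y ≠ some m} ≤
        b1.indicator 1 s + b2.indicator 1 s + e := by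
    intro s
    by_cases h1 : s ∈ b1
    · rw [Set.indicator_of_mem h1, add_assoc]
      exact prob_le_one.trans le_self_add
    by_cases h2 : s ∈ b2
    · rw [Set.indicator_of_mem h2, add_comm (Set.indicator _ _ _), add_assoc]
      exact prob_le_one.trans le_self_add
    rw [Set.indicator_of_notMem h1, Set.indicator_of_notMem h2, zero_add, zero_add]
    simp only [hb1, hb2, Set.mem_ofPred_eq, not_le] at h1 h2
    rw [← prefixSum_eq_blockSum] at h1
    rw [abs_lt] at h2
    refine dmcLaw_pulseCode_le x W hA hS.mean_nonneg hw.le hd m h1.le ?_ (by linarith)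
    have : (k : ℝ) ≤ blockSum s (m * d) n := by linarith
    exact_mod_cast this
  refine (lintegral_mono hle).trans ?_
  have hm1 : MeasurableSet b1 := (Set.to_countable _).measurableSet
  have hm2 : MeasurableSet b2 := (Set.to_countable _).measurableSet
  rw [lintegral_add_right _ measurable_const, lintegral_add_right _ (measurable_one.indicator hm2),
    lintegral_indicator_one hm1, lintegral_indicator_one hm2, lintegral_const, measure_univ, mul_one]
  have hmd := block_add_le hnd m
  gcongr
  · refine (stateLaw_blockSum_ge_le hS (by omega) hw).trans (ENNReal.ofReal_le_ofReal ?_)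
    have : ((m * d : ℕ) : ℝ) ≤ M * d := by exact_mod_cast (by omega : (m : ℕ) * d ≤ M * d)
    gcongr
  · exact stateLaw_blockSum_ge_le hS hmd hr

end PulseCode


theorem Code.avgErrorProb_le {X Y : Type*} [MeasurableSpace Y] {T M : ℕ} (C : Code X Y T M)
    {S : PMF ℕ} {W : X → PMF Y} {e : ℝ≥0∞} (h : ∀ m, C.errorProb S W m ≤ e) :
    C.avgErrorProb S W ≤ e := by
  refine ENNReal.div_le_of_le_mul ((Finset.sum_le_sum fun m _ => h m).trans_eq ?_)
  rw [Finset.sum_const, Finset.card_univ, Fintype.card_fin, nsmul_eq_mul, mul_comm]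

/-! ### Choice of parameters and lower bound -/

open Filter in
theorem tendsto_log_natCast_atTop : Tendsto (fun M : ℕ => Real.log M) atTop atTop :=
  Real.tendsto_log_atTop.comp tendsto_natCast_atTop_atTop

open Filter in
theorem eventually_ceil_log_div_le {R : ℝ} (hR : 0 < R) :
    ∀ᶠ M : ℕ in atTop, ⌈Real.log M / R⌉₊ ≤ M := by
  have h := tendsto_natCast_atTop_atTop (R := ℝ) |>.eventually
    (Real.isLittleO_log_id_atTop.def hR)
  filter_upwards [h] with M hM
  rw [Nat.ceil_le, div_le_iff₀ hR, mul_comm]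
  simpa using (le_abs_self _).trans hM

section Achievability

open Filter

variable {X Y : Type*} [Zero X] [MeasurableSpace Y]

/-- Pulses of length `log M / R` suffice for `M` messages, if `2 R` is less than the mean number
of repetitions times the divergence. -/
theorem eventually_existsCode {S : PMF ℕ} {μ σ2 : ℝ} (hS : HasMeanVar S μ σ2) (W : X → PMF Y)
    {c : X → ℝ≥0} (hc : c 0 = 0) (x : X) {D R ε : ℝ} (hD : 0 < D)
    (hDx : ENNReal.ofReal D < InformationTheory.klDiv (W x).toMeasure (W 0).toMeasure)
    (hR : 0 < R) (hRD : 2 * R < μ * D) (hε : 0 < ε) :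
    ∀ᶠ M : ℕ in atTop, ∃ T, ExistsCode S W c T M (⌈Real.log M / R⌉₊ * c x) ε := by
  have hμ : 0 < μ := pos_of_mul_pos_left (by linarith : 0 < μ * D) hD.le
  have hσ : 0 ≤ σ2 := hS.var ▸ variance_nonneg _ _
  obtain ⟨k₀, hk₀⟩ := exists_test (W x).toMeasure (W 0).toMeasure hD.le hDx
    (by positivity : 0 < ε / 4)
  obtain ⟨ρ, hρ, hμD⟩ : ∃ ρ, 0 < ρ ∧ μ * D = 2 * R + 2 * ρ :=
    ⟨(μ * D - 2 * R) / 2, by linarith, by ring⟩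
  -- `K ≥ 2μ` makes `w = KM` exceed twice the mean pulse output, as `n ≤ M`; the last bound makes
  -- the Chebyshev estimate for the drift at most `ε/4`.
  obtain ⟨K, hK1, hKμ, hKσ⟩ : ∃ K : ℝ, 1 ≤ K ∧ 2 * μ ≤ K ∧ 4 * (4 / μ + 1) * σ2 ≤ K * ε := by
    have h1 : 0 ≤ 4 * (4 / μ + 1) * σ2 / ε := by positivity
    refine ⟨1 + 2 * μ + 4 * (4 / μ + 1) * σ2 / ε, by linarith, by linarith, ?_⟩
    rw [add_mul, div_mul_cancel₀ _ hε.ne']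
    have : 0 ≤ (1 + 2 * μ) * ε := by positivity
    linarith
  have hn : Tendsto (fun M : ℕ => ⌈Real.log M / R⌉₊) atTop atTop :=
    tendsto_nat_ceil_atTop.comp (tendsto_log_natCast_atTop.atTop_div_const hR)
  -- Since `(2R + ρ)/D = μ - ρ/D`, the window is shorter than the mean pulse output by a linear
  -- margin, yet `kD ≥ n(2R + ρ) - D` still beats the `M² ≤ exp(2nR)` windows. The lost `D` comes
  -- from the floor.
  have hk : Tendsto (fun n : ℕ => ⌊(n : ℝ) * ((2 * R + ρ) / D)⌋₊) atTop atTop :=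
    tendsto_nat_floor_atTop.comp
      (tendsto_natCast_atTop_atTop.atTop_mul_const (by positivity))
  have hvar : ∀ᶠ n : ℕ in atTop, σ2 * D ^ 2 / ρ ^ 2 / (n : ℝ) < ε / 4 :=
    (tendsto_const_div_atTop_nhds_zero_nat _).eventually_lt_const (by positivity)
  have hexp : ∀ᶠ n : ℕ in atTop, (2 * K + 1) * Real.exp D * Real.exp (-(n * ρ)) < ε / 4 := by
    have h1 : Tendsto (fun n : ℕ => Real.exp (-(n * ρ))) atTop (nhds 0) :=
      Real.tendsto_exp_neg_atTop_nhds_zero.comp (tendsto_natCast_atTop_atTop.atTop_mul_const hρ)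
    have h2 := h1.const_mul ((2 * K + 1) * Real.exp D)
    rw [mul_zero] at h2
    exact h2.eventually_lt_const (by positivity)
  filter_upwards [eventually_ge_atTop 1, eventually_ceil_log_div_le hR,
    hn.eventually (eventually_ge_atTop 1), hn.eventually (hk.eventually (eventually_ge_atTop k₀)),
    hn.eventually hvar, hn.eventually hexp] with M hM1 hnM hn1 hkk₀ hv he
  have hlogn := Nat.le_ceil (Real.log M / R)
  set n := ⌈Real.log M / R⌉₊
  set k := ⌊(n : ℝ) * ((2 * R + ρ) / D)⌋₊
  obtain ⟨A, hA, hA1, hA0⟩ := hk₀ k hkk₀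
  -- The drift variance is at most `M d σ2`, of order `K M²`, while `w² = K² M²`: a large constant
  -- `K` suffices.
  set w := K * M with hw
  set d := ⌈4 * w / μ⌉₊
  have hM1' : (1 : ℝ) ≤ M := by exact_mod_cast hM1
  have hn1' : (1 : ℝ) ≤ n := by exact_mod_cast hn1
  have hnM' : (n : ℝ) ≤ M := by exact_mod_cast hnM
  have hw0 : 0 < w := by positivity
  have hd1 : 4 * w ≤ d * μ := (div_le_iff₀ hμ).1 (Nat.le_ceil (4 * w / μ))
  have hd2 : (d : ℝ) ≤ 4 * w / μ + 1 := (Nat.ceil_lt_add_one (by positivity)).le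
  have hwn : 2 * (n * μ) ≤ w := by
    rw [hw]
    nlinarith
  have hk1 : (k : ℝ) ≤ n * ((2 * R + ρ) / D) := Nat.floor_le (by positivity)
  have hk2 : n * ((2 * R + ρ) / D) < k + 1 := Nat.lt_floor_add_one _
  have hμr : (2 * R + ρ) / D = μ - ρ / D := by
    field_simp
    linarith
  have hρD : 0 < ρ / D := by positivity
  have hnρ : n * (ρ / D) ≤ n * μ := by
    have : 0 < (2 * R + ρ) / D := by positivity
    gcongr
    linarith
  have hkμ : (k : ℝ) ≤ n * μ - n * (ρ / D) := by
    rw [hμr] at hk1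
    linarith
  have hnd : n ≤ d := by
    have h1 : (n : ℝ) * μ ≤ d * μ := by nlinarith
    exact_mod_cast le_of_mul_le_mul_right h1 hμ
  refine ⟨M * d, pulseCode x M n d A μ w, fun m => pulseCode_cost_le x A μ w hc hnd m, ?_⟩
  refine Code.avgErrorProb_le _ fun m => ?_
  have hr : 0 < n * (ρ / D) := by positivity
  refine (pulseCode_errorProb_le x hS W hA hw0 hr hnd hkμ (by linarith) m).trans ?_
  have e1 : M * d * σ2 / w ^ 2 ≤ ε / 4 := by
    rw [div_le_iff₀ (by positivity)]
    calc M * d * σ2 ≤ M * (4 * w / μ + w) * σ2 := by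
          gcongr
          refine hd2.trans ?_
          gcongr
          rw [hw]
          nlinarith
      _ = M * w * (4 * (4 / μ + 1) * σ2) / 4 := by ring
      _ ≤ M * w * (K * ε) / 4 := by gcongr
      _ = ε / 4 * w ^ 2 := by
        rw [hw]
        ring
  have e2 : n * σ2 / (n * (ρ / D)) ^ 2 ≤ ε / 4 := by
    refine le_trans (le_of_eq ?_) hv.le
    field_simp
  have e3 : M * (2 * w + 1) * Real.exp (-(k * D)) ≤ ε / 4 := by
    have h1 : (M : ℝ) ≤ Real.exp (n * R) := by
      rw [← Real.log_le_iff_le_exp (by positivity)]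
      exact (div_le_iff₀ hR).1 hlogn
    have h2 : -(k * D) ≤ D - n * (2 * R + ρ) := by
      rw [← mul_div_assoc, div_lt_iff₀ hD] at hk2
      linarith
    calc M * (2 * w + 1) * Real.exp (-(k * D))
        ≤ Real.exp (n * R) * ((2 * K + 1) * Real.exp (n * R)) *
            Real.exp (D - n * (2 * R + ρ)) := by
          gcongr
          calc 2 * w + 1 ≤ (2 * K + 1) * M := by
                rw [hw]
                linarith
            _ ≤ _ := by gcongr
      _ = (2 * K + 1) * (Real.exp (n * R) * Real.exp (n * R) *
            Real.exp (D - n * (2 * R + ρ))) := by ring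
      _ = (2 * K + 1) * (Real.exp D * Real.exp (-(n * ρ))) := by
          rw [← Real.exp_add, ← Real.exp_add, ← Real.exp_add]
          congr 2
          ring
      _ ≤ ε / 4 := by
          rw [← mul_assoc]
          exact he.le
  calc _ ≤ ENNReal.ofReal (ε / 4) + ENNReal.ofReal (ε / 4) +
        (ENNReal.ofReal (ε / 4) + ENNReal.ofReal (ε / 4)) := by
        refine add_le_add (add_le_add (ENNReal.ofReal_le_ofReal e1) (ENNReal.ofReal_le_ofReal e2))
          (add_le_add hA1 ?_)
        refine le_trans ?_ (ENNReal.ofReal_le_ofReal e3)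
        rw [ENNReal.ofReal_mul (p := M * (2 * w + 1)) (by positivity)]
        gcongr
    _ = ENNReal.ofReal ε := by
        rw [← ENNReal.ofReal_add (by positivity) (by positivity),
          ← ENNReal.ofReal_add (by positivity) (by positivity)]
        congr 1
        ring

theorem achievable_of_lt {S : PMF ℕ} {μ σ2 : ℝ} (hS : HasMeanVar S μ σ2) (W : X → PMF Y)
    {c : X → ℝ≥0} (hc : c 0 = 0) (x : X) {R : ℝ≥0} (hR : 0 < R)
    (h : (R : ℝ≥0∞) < ENNReal.ofReal (μ / 2) * (divBits (W x) (W 0) / c x)) :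
    Achievable S W c R := by
  have hμ : 0 < μ := by
    by_contra! hμ
    rw [ENNReal.ofReal_of_nonpos (by linarith), zero_mul] at h
    exact absurd h not_lt_zero
  have hlog : 0 < Real.log 2 := Real.log_pos one_lt_two
  have hR' : (0 : ℝ) < R := by exact_mod_cast hR
  have hτ : ENNReal.ofReal (2 * R * c x * Real.log 2 / μ) <
      InformationTheory.klDiv (W x).toMeasure (W 0).toMeasure := by
    by_contra! hle
    refine h.not_ge ?_
    rcases eq_or_ne (c x) 0 with h0 | h0
    · have : InformationTheory.klDiv (W x).toMeasure (W 0).toMeasure = 0 := by simpa [h0] using hle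
      simp [divBits, this]
    · have hcx : (0 : ℝ) < c x := by exact_mod_cast pos_iff_ne_zero.2 h0
      calc _ ≤ ENNReal.ofReal (μ / 2) * (ENNReal.ofReal (2 * R * c x * Real.log 2 / μ) /
            ENNReal.ofReal (Real.log 2) / ENNReal.ofReal (c x)) := by
            rw [divBits, ENNReal.ofReal_coe_nnreal]
            gcongr
        _ = ENNReal.ofReal R := by
            rw [← ENNReal.ofReal_div_of_pos hlog, ← ENNReal.ofReal_div_of_pos hcx,
              ← ENNReal.ofReal_mul (by positivity)]
            congr 1
            field_simp
        _ = R := ENNReal.ofReal_coe_nnreal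
  obtain ⟨D, hD0, hτD, hDx⟩ := ENNReal.lt_iff_exists_real_btwn.1 hτ
  rw [ENNReal.ofReal_lt_ofReal_iff_of_nonneg (by positivity)] at hτD
  have hD : 0 < D := lt_of_le_of_lt (by positivity) hτD
  rw [div_lt_iff₀ hμ] at hτD
  -- `R₀` is the number of nats per pulse symbol: below `μD/2` for reliability, above `R c(x) log 2`
  -- so that the cost stays below `log₂ M / R` with room for the rounding of the pulse length.
  obtain ⟨R₀, h1, h2⟩ := exists_between (by linarith : R * c x * Real.log 2 < μ * D / 2)
  have hR₀ : 0 < R₀ := lt_of_le_of_lt (by positivity) h1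
  have hα : 0 < 1 / (Real.log 2 * R) - c x / R₀ := by
    rw [sub_pos, div_lt_div_iff₀ hR₀ (by positivity)]
    linarith
  intro ε hε
  obtain ⟨M₀, hM₀⟩ := eventually_atTop.1 ((eventually_existsCode hS W hc x hD hDx hR₀
    (by linarith) hε).and ((tendsto_log_natCast_atTop.eventually_gt_atTop 0).and
    (tendsto_log_natCast_atTop.eventually_ge_atTop (c x / (1 / (Real.log 2 * R) - c x / R₀)))))
  refine ⟨M₀, fun M hM => ?_⟩
  obtain ⟨⟨T, C, hC, herr⟩, hlogM, hlogM2⟩ := hM₀ M hM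
  have hP : 0 < Real.logb 2 M / R := div_pos (div_pos hlogM hlog) hR'
  -- The budget is chosen to give rate exactly `R`, so it is positive even when `x` is free.
  refine ⟨T, (Real.logb 2 M / R).toNNReal, Real.toNNReal_pos.2 hP, ⟨C, fun m => ?_, herr⟩, ?_⟩
  · refine (hC m).trans ?_
    rw [Real.le_toNNReal_iff_coe_le hP.le]
    push_cast
    rw [div_le_iff₀ hα] at hlogM2
    calc (⌈Real.log M / R₀⌉₊ : ℝ) * c x ≤ (Real.log M / R₀ + 1) * c x := by
          gcongr
          exact (Nat.ceil_lt_add_one (by positivity)).le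
      _ = Real.log M * (c x / R₀) + c x := by ring
      _ ≤ Real.log M * (1 / (Real.log 2 * R)) := by linarith
      _ = Real.logb 2 M / R := by
        rw [Real.logb]
        field_simp
  · have hb : Real.logb 2 M ≠ 0 := (div_pos hlogM hlog).ne'
    rw [Real.coe_toNNReal _ hP.le, div_div_cancel₀ hb]

theorem le_capacityPerUnitCost {S : PMF ℕ} {μ σ2 : ℝ} (hS : HasMeanVar S μ σ2) (W : X → PMF Y)
    {c : X → ℝ≥0} (hc : c 0 = 0) :
    ENNReal.ofReal (μ / 2) * maxDivPerCost W c ≤ capacityPerUnitCost S W c := by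
  rw [maxDivPerCost, ENNReal.mul_iSup]
  refine iSup_le fun x => ENNReal.le_of_forall_nnreal_lt fun R hR => ?_
  rcases eq_or_ne R 0 with h0 | h0
  · simp [h0]
  · exact le_iSup₂_of_le R (achievable_of_lt hS W hc x (pos_iff_ne_zero.2 h0) hR) le_rfl

end Achievability

end IndelChannel

theorem theorem3 {X Y : Type*} [Zero X] [Countable Y] [MeasurableSpace Y]
    [DiscreteMeasurableSpace Y] (S : PMF ℕ) (μ σ2 : ℝ) (hS : IndelChannel.HasMeanVar S μ σ2)
    (W : X → PMF Y) (c : X → ℝ≥0) (hc : c 0 = 0) :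
    ENNReal.ofReal (μ / 2) *
        (⨆ x : {x : X // x ≠ 0}, IndelChannel.divBits (W x) (W 0) / (c x : ℝ≥0∞)) ≤
      IndelChannel.capacityPerUnitCost S W c ∧
    IndelChannel.capacityPerUnitCost S W c ≤
      ENNReal.ofReal μ *
        (⨆ x : {x : X // x ≠ 0}, IndelChannel.divBits (W x) (W 0) / (c x : ℝ≥0∞)) :=
  ⟨IndelChannel.le_capacityPerUnitCost hS W hc, IndelChannel.capacityPerUnitCost_le hS W c⟩
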